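/- Conventions. For a simplex $x$ of dimension $n\ge 1$ in a simplicial set write $\partial x=(d_0x,\dots,d_nx)$. A tuple of $n$-simplices is \emph{filled} if it equals $\partial w$ for some $(n+1)$-simplex $w$. A Kan complex is a simplicial set in which every horn has a filling. A pointed Kan complex $(K,\star)$ is a Kan complex with a vertex $\star\in K_0$; a pointed Kan pair $(K,L,\star)$ is a Kan complex $K$ with a subcomplex $L\subset K$ that is itself a Kan complex and a vertex $\star\in L_0$. Write $\star$ also for the degenerate simplices of $\star$ in each dimension. Maps of pointed Kan complexes (pairs) are the simplicial maps preserving $\star$ (and mapping $L$ to $L'$). \emph{Absolute case.} Two $n$-simplices $x,y$ with the same boundary (no condition for $n=0$) are homotopic, $x\sim y$, if $(s_{n-1}d_0x,\dots,s_{n-1}d_{n-1}x,x,y)$ is filled. Put $$\pi_n(K,\star)=\{x\in K_n : \partial x=(\star,\dots,\star)\}/{\sim}\qquad(n\ge 0),$$ with no boundary condition for $n=0$. For $n\ge1$ the product is $[x][y]=[xy]$, where $xy$ is any $n$-simplex such that $(\star,\dots,\star,y,xy,x)$ is filled. \emph{Relative case.} For $n\ge 1$, two $n$-simplices $x,y$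 with $d_ix=d_iy$ for $1\le i\le n$ and $d_0x,d_0y\in L$ are homotopic relative to $L$, $x\sim_{\mathrm{rel}\,L}y$, if $(a,s_{n-1}d_1x,\dots,s_{n-1}d_{n-1}x,x,y)$ is filled for some $a\in L_n$. Put $$\pi_n(K,L,\star)=\{x\in K_n : \partial x=(l,\star,\dots,\star),\ l\in L_{n-1}\}/{\sim_{\mathrm{rel}\,L}}\qquad(n\ge1).$$ For $n\ge2$ the product is $[x][y]=[xy]$, where $xy$ is any $n$-simplex such that $(a,\star,\dots,\star,y,xy,x)$ is filled for some $a\in L_n$. \textbf{Theorem.} (1) For every pointed Kan complex and $n\ge0$ (every pointed Kan pair and $n\ge1$), $\sim$ (resp. $\sim_{\mathrm{rel}\,L}$) is an equivalence relation on the set of representatives used above, so $\pi_n(K,\star)$ (resp. $\pi_n(K,L,\star)$) is a well-defined set. (2) For $n\ge1$ (relative: $n\ge2$) and all representatives $x,y$ a simplex $xy$ as above exists, every such simplex is again a representative, and its class depends only on $[x]$ and $[y]$; with the resulting product $\pi_n$ is a group. (3) This group is abelian for $n\ge2$ (relative: $n\ge3$). (4) Every map $f$ of pointed Kan complexes (pairs)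 induces a well-defined map $f_*[x]=[f(x)]$ on $\pi_n$ for $n\ge0$ (relative: $n\ge1$), with $\mathrm{id}_*=\mathrm{id}$ and $(g\circ f)_*=g_*\circ f_*$; it is a group homomorphism for $n\ge1$ (relative: $n\ge2$). -/

import Mathlib

open CategoryTheory Simplicial Opposite

universe u

namespace KanHomotopy

/-- The unique `n`-simplex `⋆_n` of the subcomplex generated by a vertex `⋆`. -/
def star {X : SSet.{u}} (p : X _⦋0⦌) (n : ℕ) : X _⦋n⦌ :=
  X.map (SimplexCategory.const ⦋n⦌ ⦋0⦌ 0).op p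

section Absolute

variable {X : SSet.{u}}

/-- `∂ x = (⋆, …, ⋆)`; there is no condition on a vertex. -/
def HasTrivialBoundary (p : X _⦋0⦌) {n : ℕ} (x : X _⦋n⦌) : Prop :=
  match n, x with
  | 0, _ => True
  | n + 1, x => ∀ i : Fin (n + 2), X.δ i x = star p n

/-- Homotopy of `n`-simplices: `x` and `y` have the same boundary, and
`(s_{n-1} d_0 x, …, s_{n-1} d_{n-1} x, x, y)` is the boundary of an `(n+1)`-simplex. -/
def Homotopic {n : ℕ} (x y : X _⦋n⦌) : Prop :=
  match n, x, y with
  | 0, x, y => ∃ h : X _⦋1⦌, X.δ 0 h = x ∧ X.δ 1 h = y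
  | n + 1, x, y => (∀ i : Fin (n + 2), X.δ i x = X.δ i y) ∧
      ∃ h : X _⦋n + 2⦌,
        (∀ i : Fin (n + 1),
          X.δ i.castSucc.castSucc h = X.σ (Fin.last n) (X.δ i.castSucc x)) ∧
        X.δ (Fin.last (n + 1)).castSucc h = x ∧
        X.δ (Fin.last (n + 2)) h = y

/-- For simplices of dimension `n + 1`: `z` is a completion of the horn
`(⋆, …, ⋆, y, ?, x)`, i.e. `(⋆, …, ⋆, y, z, x)` is the boundary of an `(n+2)`-simplex. -/
def IsProduct (p : X _⦋0⦌) {n : ℕ} (x y z : X _⦋n + 1⦌) : Prop :=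
  ∃ w : X _⦋n + 2⦌,
    (∀ i : Fin n, X.δ i.castSucc.castSucc.castSucc w = star p (n + 1)) ∧
    X.δ (Fin.last n).castSucc.castSucc w = y ∧
    X.δ (Fin.last (n + 1)).castSucc w = z ∧
    X.δ (Fin.last (n + 2)) w = x

end Absolute

section Relative

variable {X : SSet.{u}}

/-- For a simplex `x` of dimension `n + 1`: `∂ x = (l, ⋆, …, ⋆)` with `l` in `A`. -/
def HasRelTrivialBoundary (A : X.Subcomplex) (p : X _⦋0⦌) {n : ℕ} (x : X _⦋n + 1⦌) : Prop :=
  X.δ 0 x ∈ A.obj (op ⦋n⦌) ∧ ∀ i : Fin (n + 1), X.δ i.succ x = star p n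

/-- Homotopy relative to `A` of simplices of dimension `m = n + 1`: `d_i x = d_i y` for `1 ≤ i ≤ m`,
`d_0 x` and `d_0 y` lie in `A`, and for some `a` in `A` the tuple
`(a, s_{m-1} d_1 x, …, s_{m-1} d_{m-1} x, x, y)` is the boundary of an `(m+1)`-simplex. -/
def RelHomotopic (A : X.Subcomplex) {n : ℕ} (x y : X _⦋n + 1⦌) : Prop :=
  (∀ i : Fin (n + 1), X.δ i.succ x = X.δ i.succ y) ∧
  X.δ 0 x ∈ A.obj (op ⦋n⦌) ∧ X.δ 0 y ∈ A.obj (op ⦋n⦌) ∧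
  ∃ h : X _⦋n + 2⦌,
    X.δ 0 h ∈ A.obj (op ⦋n + 1⦌) ∧
    (∀ i : Fin n,
      X.δ i.succ.castSucc.castSucc h = X.σ (Fin.last n) (X.δ i.succ.castSucc x)) ∧
    X.δ (Fin.last (n + 1)).castSucc h = x ∧
    X.δ (Fin.last (n + 2)) h = y

/-- For simplices of dimension `n + 2`: `z` is a completion of a horn `(a, ⋆, …, ⋆, y, ?, x)`
with `a` in `A`, i.e. `(a, ⋆, …, ⋆, y, z, x)` is the boundary of an `(n+3)`-simplex. -/
def IsRelProduct (A : X.Subcomplex) (p : X _⦋0⦌) {n : ℕ} (x y z : X _⦋n + 2⦌) : Prop :=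
  ∃ w : X _⦋n + 3⦌,
    X.δ 0 w ∈ A.obj (op ⦋n + 2⦌) ∧
    (∀ i : Fin n, X.δ i.succ.castSucc.castSucc.castSucc w = star p (n + 2)) ∧
    X.δ (Fin.last (n + 1)).castSucc.castSucc w = y ∧
    X.δ (Fin.last (n + 2)).castSucc w = z ∧
    X.δ (Fin.last (n + 3)) w = x

end Relative

/-- A pointed Kan complex `(K, ⋆)`. -/
structure PointedKan where
  space : SSet.{u}
  isKan : SSet.KanComplex space
  pt : space _⦋0⦌

namespace PointedKan

/-- Simplicial maps preserving the base point. -/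
@[ext]
structure Hom (K K' : PointedKan.{u}) where
  map : K.space ⟶ K'.space
  map_pt : map.app (op ⦋0⦌) K.pt = K'.pt

instance : Category PointedKan.{u} where
  Hom := Hom
  id K := ⟨𝟙 K.space, by simp⟩
  comp f g := ⟨f.map ≫ g.map, by simp [f.map_pt, g.map_pt]⟩

/-- The `n`-simplices with boundary in the base point. -/
def Rep (K : PointedKan.{u}) (n : ℕ) : Type u :=
  {x : K.space _⦋n⦌ // HasTrivialBoundary K.pt x}

/-- The homotopy relation on the representatives. -/
def Rel (K : PointedKan.{u}) (n : ℕ) (x y : K.Rep n) : Prop := Homotopic x.1 y.1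

/-- `π_n(K, ⋆)`: the representatives modulo (the equivalence relation generated by) homotopy. -/
def Pi (K : PointedKan.{u}) (n : ℕ) : Type u := Quot (K.Rel n)

/-- The class of an `n`-simplex with boundary in the base point. -/
def cls (K : PointedKan.{u}) {n : ℕ} (x : K.space _⦋n⦌) (hx : HasTrivialBoundary K.pt x) :
    K.Pi n := Quot.mk _ ⟨x, hx⟩

end PointedKan

/-- A pointed Kan pair `(K, L, ⋆)`: both `K` and the subcomplex `L` are Kan complexes. -/
structure PointedKanPair where
  space : SSet.{u}
  sub : space.Subcomplex
  isKan : SSet.KanComplex space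
  isKan_sub : SSet.KanComplex (sub : SSet.{u})
  pt : space _⦋0⦌
  pt_mem : pt ∈ sub.obj (op ⦋0⦌)

namespace PointedKanPair

/-- Simplicial maps preserving the subcomplexes and the base points. -/
@[ext]
structure Hom (K K' : PointedKanPair.{u}) where
  map : K.space ⟶ K'.space
  map_sub : ∀ (n : ℕ) (x : K.space _⦋n⦌), x ∈ K.sub.obj (op ⦋n⦌) →
    map.app (op ⦋n⦌) x ∈ K'.sub.obj (op ⦋n⦌)
  map_pt : map.app (op ⦋0⦌) K.pt = K'.pt

instance : Category PointedKanPair.{u} where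
  Hom := Hom
  id K := ⟨𝟙 K.space, by simp, by simp⟩
  comp f g := ⟨f.map ≫ g.map,
    fun n x hx => by simpa using g.map_sub n _ (f.map_sub n x hx),
    by simp [f.map_pt, g.map_pt]⟩

/-- The simplices of dimension `n + 1` with boundary `(l, ⋆, …, ⋆)`, `l` in the subcomplex. -/
def RepSucc (K : PointedKanPair.{u}) (n : ℕ) : Type u :=
  {x : K.space _⦋n + 1⦌ // HasRelTrivialBoundary K.sub K.pt x}

/-- The relative homotopy relation on the representatives of dimension `n + 1`. -/
def RelSucc (K : PointedKanPair.{u}) (n : ℕ) (x y : K.RepSucc n) : Prop :=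
  RelHomotopic K.sub x.1 y.1

/-- `π_{n+1}(K, L, ⋆)`: the representatives of dimension `n + 1` modulo
(the equivalence relation generated by) relative homotopy. -/
def PiSucc (K : PointedKanPair.{u}) (n : ℕ) : Type u := Quot (K.RelSucc n)

/-- The class in `π_{n+1}(K, L, ⋆)` of a representative. -/
def cls (K : PointedKanPair.{u}) {n : ℕ} (x : K.space _⦋n + 1⦌)
    (hx : HasRelTrivialBoundary K.sub K.pt x) : K.PiSucc n := Quot.mk _ ⟨x, hx⟩

end PointedKanPair

end KanHomotopy

/-!
Both halves of the theorem come from one principle. Fillings of all but one of the boundaries of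
the faces of an `(n + 2)`-simplex form a horn, and filling that horn fills the remaining boundary.
A family of boundaries that fit together is the same thing as a symmetric matrix of `n`-simplices:
its rows, with the diagonal entry omitted, are the tuples to be filled (`Filled.row_of_symm`).
Equivalence of homotopy, independence of the product of representatives and associativity follow
by writing down matrices whose entries are `⋆` outside a small block and whose remaining rows are
filled by hypothesis or by degenerate simplices; solving product equations is filling a horn whose
faces have trivial boundary.

For commutativity in dimension at least `2`, every representative `a` has a partner `φ a` such that
`(⋆, …, ⋆, a, ⋆, ⋆, φ a)` is filled. If `(⋆, …, ⋆, a, b, c)` is filled, so that `b` is a product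
`ca`, then a matrix argument fills `(⋆, …, ⋆, c, b, φ a, ⋆)` (`IsProduct.filled_shift`). For `c = ⋆`
this gives `φ a ∼ a`. A second matrix turns `(⋆, …, ⋆, c, b, φ a, ⋆)` into the filled tuple
`(⋆, …, ⋆, φ c, φ b, φ (φ a))`, whence `b` is also a product `ac` on classes.

The relative case reduces to the absolute one. The `(n + 1)`-simplices of `K` whose initial vertex
is `⋆` and whose face `d₀` lies in `L` are the `n`-simplices of a simplicial set `pathSpace`, with
face maps `d₁, …, d_{n+1}`. It is a Kan complex (`pathSpace.kanComplex`), and relative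
representatives, homotopies and products in `K` are exactly the absolute ones in it, one dimension
lower (`pathSpace.hasTrivialBoundary_iff`, `pathSpace.relHomotopic_iff`,
`pathSpace.isRelProduct_iff`).
-/

namespace KanHomotopy

section

variable {X : SSet.{u}}

/-! ### Horn filling in terms of faces -/

/-- Only the faces `y j` with `j ≠ k` matter; `y k` is a dummy value. -/
theorem exists_simplex_of_horn (hX : SSet.KanComplex X) {n : ℕ} (k : Fin (n + 3))
    (y : Fin (n + 3) → X _⦋n + 1⦌)
    (hy : ∀ i j : Fin (n + 2), i ≤ j → i.castSucc ≠ k → j.succ ≠ k →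
      X.δ i (y j.succ) = X.δ j (y i.castSucc)) :
    ∃ v : X _⦋n + 2⦌, ∀ j ≠ k, X.δ j v = y j := by
  obtain ⟨φ, hφ⟩ := SSet.KanComplex.iff.1 hX (i := k)
    (fun j _ ↦ SSet.yonedaEquiv.symm (y j)) (by
      rw [SSet.horn.isCompatible_iff]
      intro i j hi hj hij
      obtain ⟨i, rfl⟩ := i.eq_castSucc_of_ne_last (Fin.ne_last_of_lt hij)
      obtain ⟨j, rfl⟩ := j.eq_succ_of_ne_zero (Fin.ne_zero_of_lt hij)
      rw [Fin.pred_succ, Fin.castPred_castSucc, SSet.stdSimplex.δ_comp_yonedaEquiv_symm,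
        SSet.stdSimplex.δ_comp_yonedaEquiv_symm, hy i j (Fin.castSucc_lt_succ_iff.1 hij) hi hj])
  refine ⟨SSet.yonedaEquiv φ, fun j hj ↦ ?_⟩
  rw [← SSet.stdSimplex.yonedaEquiv_δ_comp, hφ j hj, Equiv.apply_symm_apply]

/-- Horns of dimension `1` are filled by degenerate edges in every simplicial set, so only horns
of dimension at least `2` have to be considered. -/
theorem kanComplex_of_exists_simplex
    (h : ∀ (n : ℕ) (k : Fin (n + 3)) (y : Fin (n + 3) → X _⦋n + 1⦌),
      (∀ i j : Fin (n + 2), i ≤ j → i.castSucc ≠ k → j.succ ≠ k →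
        X.δ i (y j.succ) = X.δ j (y i.castSucc)) →
      ∃ v : X _⦋n + 2⦌, ∀ j ≠ k, X.δ j v = y j) :
    SSet.KanComplex X := by
  refine SSet.KanComplex.iff.2 fun n k f hf ↦ ?_
  let y (j : Fin (n + 2)) : X _⦋n⦌ := SSet.yonedaEquiv
    (if hj : j ≠ k then f j hj else f (k.succAbove 0) (Fin.succAbove_ne k 0))
  have hy (j : Fin (n + 2)) (hj : j ≠ k) : f j hj = SSet.yonedaEquiv.symm (y j) := by
    simp [y, hj]
  suffices ∃ v : X _⦋n + 1⦌, ∀ j ≠ k, X.δ j v = y j by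
    obtain ⟨v, hv⟩ := this
    refine ⟨SSet.yonedaEquiv.symm v, fun j hj ↦ ?_⟩
    rw [SSet.stdSimplex.δ_comp_yonedaEquiv_symm, hv j hj, hy]
  obtain _ | n := n
  · refine ⟨X.σ 0 (y (k.succAbove 0)), fun j hj ↦ ?_⟩
    have e (j : Fin 2) : X.δ j (X.σ 0 (y (k.succAbove 0))) = y (k.succAbove 0) := by
      obtain rfl | rfl : j = Fin.castSucc 0 ∨ j = Fin.succ 0 := by
        revert j; decide
      · exact X.δ_comp_σ_self_apply 0 _
      · exact X.δ_comp_σ_succ_apply 0 _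
    rw [e]
    congr 1
    exact (by decide : ∀ j k : Fin 2, j ≠ k → k.succAbove 0 = j) j k hj
  · refine h n k y fun i j hij hi hj ↦ ?_
    have := (SSet.horn.isCompatible_iff _).1 hf i.castSucc j.succ hi hj
      (Fin.castSucc_lt_succ_iff.2 hij)
    rw [hy, hy, Fin.pred_succ, Fin.castPred_castSucc, SSet.stdSimplex.δ_comp_yonedaEquiv_symm,
        SSet.stdSimplex.δ_comp_yonedaEquiv_symm] at this
    exact (SSet.yonedaEquiv.symm.injective this).symm

/-! ### Filled tuples -/

/-- The tuple of `n`-simplices whose entries are listed by `f` starting from the last one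
is the boundary of an `(n + 1)`-simplex. Counting from the end, the interesting entries of the
tuples that define homotopies and products sit at positions that do not depend on `n`.
Values of `f` beyond `n + 1` are irrelevant. -/
def Filled {n : ℕ} (f : ℕ → X _⦋n⦌) : Prop :=
  ∃ w : X _⦋n + 1⦌, ∀ i : Fin (n + 2), X.δ i w = f (n + 1 - i)

/-- In a Kan complex let `b` be a symmetric matrix of simplices. Its rows, with the diagonal
entry omitted, are possible boundaries; fillings of all rows but one form a horn, and the
missing face of a filling of that horn fills the remaining row. -/
theorem Filled.row_of_symm (hX : SSet.KanComplex X) {n : ℕ} (b : ℕ → ℕ → X _⦋n⦌)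
    (symm : ∀ i j, b i j = b j i) (k : ℕ) (hk : k ≤ n + 2)
    (h : ∀ r ≤ n + 2, r ≠ k → Filled fun i ↦ b r (if i < r then i else i + 1)) :
    Filled fun i ↦ b k (if i < k then i else i + 1) := by
  have row (j : Fin (n + 3)) : ∃ w : X _⦋n + 1⦌, (n + 2 - j.val ≠ k → ∀ i : Fin (n + 2),
      X.δ i w = b (n + 2 - j) (n + 2 - j.succAbove i)) := by
    by_cases hj : n + 2 - j.val = k
    -- The row `k` is not given; any simplex may stand in its place.
    · exact ⟨X.map (SimplexCategory.const _ _ 0).op (b 0 0), fun h ↦ absurd hj h⟩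
    · obtain ⟨w, hw⟩ := h (n + 2 - j) (by lia) hj
      refine ⟨w, fun _ i ↦ (hw i).trans ?_⟩
      beta_reduce
      congr 1
      obtain hij | hij := lt_or_ge i.castSucc j
      · rw [Fin.succAbove_of_castSucc_lt _ _ hij]
        rw [Fin.lt_def, Fin.val_castSucc] at hij
        rw [if_neg (by lia), Fin.val_castSucc]
        lia
      · rw [Fin.succAbove_of_le_castSucc _ _ hij]
        rw [Fin.le_def, Fin.val_castSucc] at hij
        rw [if_pos (by lia), Fin.val_succ]
        lia
  choose w hw using row
  obtain ⟨v, hv⟩ := exists_simplex_of_horn hX (⟨n + 2 - k, by lia⟩ : Fin (n + 3)) w (by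
    intro i j hij hi hj
    rw [hw _ (by simp [Fin.ext_iff] at hj ⊢; lia), hw _ (by simp [Fin.ext_iff] at hi ⊢; lia),
      Fin.succAbove_of_castSucc_lt _ _ (by simpa [Fin.lt_def, Nat.lt_succ_iff] using hij),
      Fin.succAbove_of_le_castSucc _ _ (by simpa using hij), symm])
  refine ⟨X.δ ⟨n + 2 - k, by lia⟩ v, fun i ↦ ?_⟩
  obtain hik | hik := lt_or_ge i.val (n + 2 - k)
  · have hne : i.castSucc ≠ ⟨n + 2 - k, by lia⟩ := by simp [Fin.ext_iff]; lia
    rw [X.δ_comp_δ'_apply (j := ⟨n + 2 - k, by lia⟩) (by simpa [Fin.lt_def] using hik), hv _ hne,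
      hw _ (by simp; lia), symm]
    rw [Fin.succAbove_of_le_castSucc _ _ (by simp [Fin.le_def]; lia)]
    have : ¬ n + 1 - i.val < k := by lia
    simp only [this, if_false]
    congr 1
    · simp; lia
    · simp; lia
  · have hne : i.succ ≠ ⟨n + 2 - k, by lia⟩ := by simp [Fin.ext_iff]; lia
    have := X.δ_comp_δ''_apply (i := ⟨n + 2 - k, by lia⟩) (j := i)
      (by simpa [Fin.le_def] using hik) v
    rw [hv _ hne, hw _ (by simp; lia), symm,
      Fin.succAbove_of_castSucc_lt _ _ (by simp [Fin.lt_def]; lia)] at this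
    rw [← this]
    have : n + 1 - i.val < k := by lia
    simp only [this, if_true]
    congr 1
    · simp; lia
    · simp

variable (p : X _⦋0⦌) {n : ℕ}

/-- The tuple `(⋆, …, ⋆, a, b, c, d)`, listed from its end as in `Filled`; for small `n` its
first entries are cut off. -/
def tuple (d c b a : X _⦋n⦌) (i : ℕ) : X _⦋n⦌ := [d, c, b, a].getD i (star p n)

theorem map_star {m n : ℕ} (f : ⦋m⦌ ⟶ ⦋n⦌) :
    X.map f.op (star p n) = star p m := by
  simp only [star, ← CategoryTheory.comp_apply, ← Functor.map_comp, ← op_comp]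
  congr 4

@[simp]
theorem δ_star (i : Fin (n + 2)) : X.δ i (star p (n + 1)) = star p n := map_star p _

@[simp]
theorem σ_star (i : Fin (n + 1)) : X.σ i (star p n) = star p (n + 1) := map_star p _

@[simp]
theorem star_zero : star p 0 = p := by simp [star]

theorem app_star {Y : SSet.{u}} (f : X ⟶ Y) (n : ℕ) :
    f.app (op ⦋n⦌) (star p n) = star (f.app (op ⦋0⦌) p) n := by
  simp [star, NatTrans.naturality_apply]

theorem hasTrivialBoundary_star : HasTrivialBoundary p (star p n) := by
  cases n
  · trivial
  · exact fun i ↦ δ_star p i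

theorem filled_star : Filled (tuple p (star p n) (star p n) (star p n) (star p n)) :=
  ⟨star p (n + 1), fun i ↦ (δ_star p i).trans (by
    generalize n + 1 - i.val = j
    rcases j with _ | _ | _ | _ | j <;> rfl)⟩

theorem Filled.const_star : Filled (fun _ ↦ star p n) :=
  ⟨star p (n + 1), fun i ↦ δ_star p i⟩

/-- The rows, with their diagonal entries omitted, of the symmetric matrix with entries
`eᵢⱼ = eⱼᵢ` and `⋆` elsewhere. -/
def rows (e₀₁ e₀₂ e₀₃ e₀₄ e₁₂ e₁₃ e₁₄ e₂₃ e₂₄ e₃₄ : X _⦋n⦌) (r : ℕ) : ℕ → X _⦋n⦌ :=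
  [tuple p e₀₁ e₀₂ e₀₃ e₀₄, tuple p e₀₁ e₁₂ e₁₃ e₁₄, tuple p e₀₂ e₁₂ e₂₃ e₂₄,
    tuple p e₀₃ e₁₃ e₂₃ e₃₄, tuple p e₀₄ e₁₄ e₂₄ e₃₄].getD r fun _ ↦ star p n

/-- The case of `Filled.row_of_symm` that carries all later arguments: apart from `⋆`, the matrix
has entries only in its last five rows and columns, numbered from the end. In the applications it
is described by its entries above the diagonal, row by row. -/
theorem Filled.row (hX : SSet.KanComplex X)
    (e₀₁ e₀₂ e₀₃ e₀₄ e₁₂ e₁₃ e₁₄ e₂₃ e₂₄ e₃₄ : X _⦋n⦌) (k : ℕ) (hk : k ≤ n + 2)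
    (h₀ : k ≠ 0 → Filled (tuple p e₀₁ e₀₂ e₀₃ e₀₄))
    (h₁ : k ≠ 1 → Filled (tuple p e₀₁ e₁₂ e₁₃ e₁₄))
    (h₂ : k ≠ 2 → Filled (tuple p e₀₂ e₁₂ e₂₃ e₂₄))
    (h₃ : k ≠ 3 → Filled (tuple p e₀₃ e₁₃ e₂₃ e₃₄))
    (h₄ : k ≠ 4 → Filled (tuple p e₀₄ e₁₄ e₂₄ e₃₄)) :
    Filled (rows p e₀₁ e₀₂ e₀₃ e₀₄ e₁₂ e₁₃ e₁₄ e₂₃ e₂₄ e₃₄ k) := by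
  -- The entries above the diagonal.
  let u (i j : ℕ) : X _⦋n⦌ := match i, j with
    | 0, 1 => e₀₁
    | 0, 2 => e₀₂
    | 0, 3 => e₀₃
    | 0, 4 => e₀₄
    | 1, 2 => e₁₂
    | 1, 3 => e₁₃
    | 1, 4 => e₁₄
    | 2, 3 => e₂₃
    | 2, 4 => e₂₄
    | 3, 4 => e₃₄
    | _, _ => star p n
  have hu (i j : ℕ) (hj : 5 ≤ j) : u i j = star p n := by
    obtain ⟨j, rfl⟩ := Nat.exists_eq_add_of_le' hj
    rcases i with _ | _ | _ | _ | _ | i <;> rfl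
  have row (r : ℕ) : (fun i ↦ u (min r (if i < r then i else i + 1))
      (max r (if i < r then i else i + 1))) =
      rows p e₀₁ e₀₂ e₀₃ e₀₄ e₁₂ e₁₃ e₁₄ e₂₃ e₂₄ e₃₄ r := by
    funext i
    by_cases hr : 5 ≤ r
    · rw [hu _ _ (by lia)]
      obtain ⟨r, rfl⟩ := Nat.exists_eq_add_of_le' hr
      rfl
    · by_cases hi : 4 ≤ i
      · rw [hu _ _ (by lia)]
        obtain ⟨i, rfl⟩ := Nat.exists_eq_add_of_le' hi
        interval_cases r <;> rfl
      · interval_cases r <;> interval_cases i <;> rfl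
  rw [← row]
  refine Filled.row_of_symm hX (fun i j ↦ u (min i j) (max i j))
    (fun i j ↦ by rw [min_comm, max_comm]) k hk fun r _ hrk ↦ ?_
  rw [row]
  match r, hrk with
  | 0, hrk => exact h₀ hrk.symm
  | 1, hrk => exact h₁ hrk.symm
  | 2, hrk => exact h₂ hrk.symm
  | 3, hrk => exact h₃ hrk.symm
  | 4, hrk => exact h₄ hrk.symm
  | _ + 5, _ => exact Filled.const_star p

variable {p}

/-- The boundary of a degenerate simplex `σᵢ x` has two adjacent entries `x`. -/
theorem filled_degenerate {x : X _⦋n⦌} (hx : HasTrivialBoundary p x) (j : ℕ) (hj : j ≤ n) :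
    Filled fun i ↦ if i = j ∨ i = j + 1 then x else star p n := by
  refine ⟨X.σ ⟨n - j, by lia⟩ x, fun i ↦ ?_⟩
  beta_reduce
  have := i.isLt
  obtain h | h | h | h : i.val < n - j ∨ i.val = n - j ∨ i.val = n - j + 1 ∨ n - j + 1 < i.val := by
    lia
  · obtain ⟨n, rfl⟩ : ∃ m, n = m + 1 := ⟨n - 1, by lia⟩
    rw [if_neg (by lia)]
    obtain ⟨i, rfl⟩ := i.eq_castSucc_of_ne_last (by rintro rfl; simp at h; lia)
    rw [Fin.val_castSucc] at h
    have e : (⟨n + 1 - j, by lia⟩ : Fin (n + 2)) = Fin.succ ⟨n - j, by lia⟩ :=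
      Fin.ext (by rw [Fin.val_succ]; lia)
    rw [e, X.δ_comp_σ_of_le_apply (by rw [Fin.le_def, Fin.val_castSucc]; lia), hx i, σ_star]
  · rw [if_pos (by lia)]
    exact X.δ_comp_σ_self'_apply (Fin.ext h) x
  · rw [if_pos (by lia)]
    exact X.δ_comp_σ_succ'_apply (Fin.ext h) x
  · obtain ⟨n, rfl⟩ : ∃ m, n = m + 1 := ⟨n - 1, by lia⟩
    rw [if_neg (by lia)]
    rw [X.δ_comp_σ_of_gt'_apply (by simpa [Fin.lt_def] using h), hx, σ_star]

theorem Filled.congr {f g : ℕ → X _⦋n⦌} (h : Filled f) (hfg : ∀ i ≤ n + 1, f i = g i) :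
    Filled g := by
  obtain ⟨w, hw⟩ := h
  exact ⟨w, fun i ↦ (hw i).trans (hfg _ (by lia))⟩

theorem filled_degenerate_zero {x : X _⦋n⦌} (hx : HasTrivialBoundary p x) :
    Filled (tuple p x x (star p n) (star p n)) :=
  (filled_degenerate hx 0 (by lia)).congr fun i _ ↦ by
    rcases i with _ | _ | _ | _ | i <;> rfl

theorem filled_degenerate_one {x : X _⦋n + 1⦌} (hx : HasTrivialBoundary p x) :
    Filled (tuple p (star p (n + 1)) x x (star p (n + 1))) :=
  (filled_degenerate hx 1 (by lia)).congr fun i _ ↦ by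
    rcases i with _ | _ | _ | _ | i <;> rfl

theorem filled_degenerate_two {x : X _⦋n + 2⦌} (hx : HasTrivialBoundary p x) :
    Filled (tuple p (star p (n + 2)) (star p (n + 2)) x x) :=
  (filled_degenerate hx 2 (by lia)).congr fun i _ ↦ by
    rcases i with _ | _ | _ | _ | i <;> rfl

/-- If all faces but one of a simplex have trivial boundary, then so has the remaining one. -/
theorem hasTrivialBoundary_δ (k : Fin (n + 2)) (w : X _⦋n + 1⦌)
    (hw : ∀ i ≠ k, HasTrivialBoundary p (X.δ i w)) : HasTrivialBoundary p (X.δ k w) := by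
  obtain _ | n := n
  · trivial
  intro i
  obtain hik | hik := lt_or_ge i.castSucc k
  · rw [X.δ_comp_δ'_apply hik]
    exact hw _ hik.ne _
  · have := X.δ_comp_δ''_apply hik w
    rw [← this]
    exact hw i.succ (by rintro rfl; simp [Fin.le_def] at hik) _

/-- A horn whose faces have trivial boundary can be filled, since its compatibility conditions
all read `⋆ = ⋆`. The entry of `f` at the missing position `k` is replaced by the new face. -/
theorem exists_filled (hX : SSet.KanComplex X) (f : ℕ → X _⦋n + 1⦌)
    (k : ℕ) (hk : k ≤ n + 2) (hf : ∀ i ≤ n + 2, i ≠ k → HasTrivialBoundary p (f i)) :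
    ∃ z, HasTrivialBoundary p z ∧ Filled (Function.update f k z) := by
  obtain ⟨w, hw⟩ := exists_simplex_of_horn hX (⟨n + 2 - k, by lia⟩ : Fin (n + 3))
    (fun i ↦ f (n + 2 - i)) fun i j hij hi hj ↦ by
      rw [hf _ (by lia) (by simp [Fin.ext_iff] at hj ⊢; lia) i,
        hf _ (by lia) (by simp [Fin.ext_iff] at hi ⊢; lia) j]
  refine ⟨X.δ ⟨n + 2 - k, by lia⟩ w, hasTrivialBoundary_δ _ _ fun i hi ↦ ?_, w, fun i ↦ ?_⟩
  · rw [hw i hi]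
    exact hf _ (by lia) (by simp [Fin.ext_iff] at hi ⊢; lia)
  · by_cases hi : i = ⟨n + 2 - k, by lia⟩
    · subst hi
      have : n + 1 + 1 - (n + 2 - k) = k := by lia
      simp [this]
    · rw [hw i hi, Function.update_of_ne]
      simp [Fin.ext_iff] at hi ⊢; lia

/-! ### Homotopies and products as filled tuples -/

theorem HasTrivialBoundary.app {Y : SSet.{u}} {x : X _⦋n⦌} (hx : HasTrivialBoundary p x)
    (f : X ⟶ Y) : HasTrivialBoundary (f.app (op ⦋0⦌) p) (f.app (op ⦋n⦌) x) := by
  obtain _ | n := n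
  · trivial
  · intro i
    rw [← SSet.δ_naturality_apply, hx i, app_star]

theorem Filled.app_tuple {Y : SSet.{u}} {d c b a : X _⦋n⦌} (h : Filled (tuple p d c b a))
    (f : X ⟶ Y) : Filled (tuple (f.app (op ⦋0⦌) p) (f.app _ d) (f.app _ c) (f.app _ b)
      (f.app _ a)) := by
  obtain ⟨w, hw⟩ := h
  refine ⟨f.app _ w, fun i ↦ ?_⟩
  rw [← SSet.δ_naturality_apply, hw i]
  generalize n + 1 - i.val = j
  rcases j with _ | _ | _ | _ | j
  iterate 4 rfl
  exact app_star p f n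

theorem homotopic_iff_filled {x y : X _⦋n⦌} (hx : HasTrivialBoundary p x)
    (hy : HasTrivialBoundary p y) :
    Homotopic x y ↔ Filled (tuple p y x (star p n) (star p n)) := by
  obtain _ | n := n
  · refine exists_congr fun w ↦ ?_
    rw [Fin.forall_fin_two]
    rfl
  · refine (and_iff_right fun i ↦ (hx i).trans (hy i).symm).trans (exists_congr fun w ↦ ?_)
    rw [Fin.forall_fin_succ' (n := n + 2), Fin.forall_fin_succ' (n := n + 1), and_assoc]
    refine and_congr (forall_congr' fun i ↦ ?_) (and_congr ?_ ?_)
    · rw [hx, σ_star]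
      obtain ⟨k, hk⟩ : ∃ k, n + 1 + 1 - i.castSucc.castSucc.val = k + 2 :=
        ⟨n - i, by simp; lia⟩
      rw [hk]
      rcases k with _ | _ | k <;> rfl
    · have : n + 1 + 1 - (Fin.last (n + 1)).castSucc.val = 1 := by simp
      rw [this]
      rfl
    · have : n + 1 + 1 - (Fin.last (n + 1 + 1)).val = 0 := by simp
      rw [this]
      rfl

theorem isProduct_iff_filled {x y z : X _⦋n + 1⦌} :
    IsProduct p x y z ↔ Filled (tuple p x z y (star p (n + 1))) := by
  refine exists_congr fun w ↦ ?_
  rw [Fin.forall_fin_succ', Fin.forall_fin_succ', Fin.forall_fin_succ', and_assoc, and_assoc]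
  refine and_congr (forall_congr' fun i ↦ ?_) (and_congr ?_ (and_congr ?_ ?_))
  · obtain ⟨k, hk⟩ : ∃ k, n + 1 + 1 - i.castSucc.castSucc.castSucc.val = k + 3 :=
      ⟨n - 1 - i, by simp; lia⟩
    rw [hk]
    rcases k with _ | k <;> rfl
  · have : n + 1 + 1 - (Fin.last n).castSucc.castSucc.val = 2 := by simp; lia
    rw [this]
    rfl
  · have : n + 1 + 1 - (Fin.last (n + 1)).castSucc.val = 1 := by simp
    rw [this]
    rfl
  · have : n + 1 + 1 - (Fin.last (n + 1 + 1)).val = 0 := by simp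
    rw [this]
    rfl

/-! ### Homotopy is an equivalence relation -/

theorem Homotopic.refl {x : X _⦋n⦌} (hx : HasTrivialBoundary p x) : Homotopic x x :=
  (homotopic_iff_filled hx hx).2 (filled_degenerate_zero hx)

/-- Together with reflexivity this makes homotopy an equivalence relation. -/
theorem Homotopic.euclidean (hX : SSet.KanComplex X) {x y z : X _⦋n⦌}
    (hx : HasTrivialBoundary p x) (hy : HasTrivialBoundary p y) (hz : HasTrivialBoundary p z)
    (hxy : Homotopic x y) (hxz : Homotopic x z) : Homotopic y z := by
  rw [homotopic_iff_filled hx hy] at hxy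
  rw [homotopic_iff_filled hx hz] at hxz
  rw [homotopic_iff_filled hy hz]
  exact Filled.row p hX z y (star p n) (star p n) x (star p n) (star p n) (star p n) (star p n)
    (star p n) 0 (by lia) (absurd rfl) (fun _ ↦ hxz) (fun _ ↦ hxy) (fun _ ↦ filled_star p)
    (fun _ ↦ filled_star p)

theorem PointedKan.rel_equivalence (K : PointedKan.{u}) (n : ℕ) : Equivalence (K.Rel n) where
  refl x := Homotopic.refl x.2
  symm {x y} h := Homotopic.euclidean K.isKan x.2 y.2 x.2 h (Homotopic.refl x.2)
  trans {x y z} hxy hyz :=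
    Homotopic.euclidean K.isKan y.2 x.2 z.2
      (Homotopic.euclidean K.isKan x.2 y.2 x.2 hxy (Homotopic.refl x.2)) hyz

/-! ### The product -/

theorem IsProduct.hasTrivialBoundary {x y z : X _⦋n + 1⦌} (hx : HasTrivialBoundary p x)
    (hy : HasTrivialBoundary p y) (h : IsProduct p x y z) : HasTrivialBoundary p z := by
  obtain ⟨w, h₁, rfl, rfl, rfl⟩ := h
  refine hasTrivialBoundary_δ _ _ fun i ↦ ?_
  induction i using Fin.lastCases with
  | last => exact fun _ ↦ hx
  | cast i =>
    induction i using Fin.lastCases with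
    | last => exact fun h ↦ absurd rfl h
    | cast i =>
      induction i using Fin.lastCases with
      | last => exact fun _ ↦ hy
      | cast i => rw [h₁]; exact fun _ ↦ hasTrivialBoundary_star p

theorem exists_isProduct (hX : SSet.KanComplex X) {x y : X _⦋n + 1⦌}
    (hx : HasTrivialBoundary p x) (hy : HasTrivialBoundary p y) :
    ∃ z, HasTrivialBoundary p z ∧ IsProduct p x y z := by
  obtain ⟨z, hz, h⟩ := exists_filled (p := p) hX (tuple p x x y (star p (n + 1))) 1 (by lia) (by
    intro i _ _
    rcases i with _ | _ | _ | _ | i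
    exacts [hx, hx, hy, hasTrivialBoundary_star p, hasTrivialBoundary_star p])
  refine ⟨z, hz, isProduct_iff_filled.2 (h.congr fun i _ ↦ ?_)⟩
  rcases i with _ | _ | _ | _ | i <;> rfl

/-- The product equation with right factor `y` and product `⋆` can be solved. -/
theorem exists_isProduct_star (hX : SSet.KanComplex X) {y : X _⦋n + 1⦌}
    (hy : HasTrivialBoundary p y) :
    ∃ x, HasTrivialBoundary p x ∧ IsProduct p x y (star p (n + 1)) := by
  obtain ⟨z, hz, h⟩ := exists_filled (p := p) hX
      (tuple p y (star p (n + 1)) y (star p (n + 1))) 0 (by lia) (by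
    intro i _ _
    rcases i with _ | _ | _ | _ | i
    exacts [hy, hasTrivialBoundary_star p, hy, hasTrivialBoundary_star p,
      hasTrivialBoundary_star p])
  refine ⟨z, hz, isProduct_iff_filled.2 (h.congr fun i _ ↦ ?_)⟩
  rcases i with _ | _ | _ | _ | i <;> rfl

/-- The two products occupy rows `1` and `2`, the homotopy row `0`. -/
theorem IsProduct.congr_left (hX : SSet.KanComplex X) {x x' y z : X _⦋n + 1⦌}
    (hx : HasTrivialBoundary p x) (hx' : HasTrivialBoundary p x') (hy : HasTrivialBoundary p y)
    (h : IsProduct p x y z) (hxx' : Homotopic x x') : IsProduct p x' y z := by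
  rw [isProduct_iff_filled] at h ⊢
  rw [homotopic_iff_filled hx hx'] at hxx'
  let s := star p (n + 1)
  exact Filled.row p hX x' x s s z y s y s s 1 (by lia) (fun _ ↦ hxx') (absurd rfl) (fun _ ↦ h)
    (fun _ ↦ filled_degenerate_one hy) (fun _ ↦ filled_star p)

/-- The two products occupy rows `0` and `1`, the homotopies rows `2` and `3`. -/
theorem IsProduct.homotopic (hX : SSet.KanComplex X) {x y y' z z' : X _⦋n + 1⦌}
    (hx : HasTrivialBoundary p x) (hy : HasTrivialBoundary p y) (hy' : HasTrivialBoundary p y')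
    (h : IsProduct p x y z) (h' : IsProduct p x y' z') (hyy' : Homotopic y y') :
    Homotopic z z' := by
  rw [homotopic_iff_filled (h.hasTrivialBoundary hx hy) (h'.hasTrivialBoundary hx hy')]
  rw [isProduct_iff_filled] at h h'
  rw [homotopic_iff_filled hy hy'] at hyy'
  let s := star p (n + 1)
  exact Filled.row p hX x z' y' s z y s s s s 2 (by lia) (fun _ ↦ h') (fun _ ↦ h) (absurd rfl)
    (fun _ ↦ hyy') (fun _ ↦ filled_star p)

/-- The tuples of the products `xy`, `x(yz)`, `(xy)z` and `yz` are, in this order counted from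
the end, the four nonconstant rows of one symmetric matrix. -/
theorem IsProduct.assoc (hX : SSet.KanComplex X) {x y z xy yz w : X _⦋n + 1⦌}
    (hxy : IsProduct p x y xy) (hyz : IsProduct p y z yz) (h : IsProduct p x yz w) :
    IsProduct p xy z w := by
  rw [isProduct_iff_filled] at *
  let s := star p (n + 1)
  exact Filled.row p hX x xy y s w yz s z s s 2 (by lia) (fun _ ↦ hxy) (fun _ ↦ h) (absurd rfl)
    (fun _ ↦ hyz) (fun _ ↦ filled_star p)

theorem isProduct_star_left {x : X _⦋n + 1⦌} (hx : HasTrivialBoundary p x) :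
    IsProduct p (star p (n + 1)) x x :=
  isProduct_iff_filled.2 (filled_degenerate_one hx)

/-! ### Commutativity -/

/-- A simplex `a` has a partner `d` such that `(⋆, …, ⋆, a, ⋆, ⋆, d)` is filled. By
`homotopic_of_filled_first_last` below, `d` is homotopic to `a`. -/
theorem exists_filled_first_last (hX : SSet.KanComplex X) {a : X _⦋n + 2⦌}
    (ha : HasTrivialBoundary p a) : ∃ d, HasTrivialBoundary p d ∧
      Filled (tuple p d (star p (n + 2)) (star p (n + 2)) a) := by
  obtain ⟨d, hd, h⟩ := exists_filled (p := p) hX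
      (tuple p a (star p (n + 2)) (star p (n + 2)) a) 0 (by lia) (by
    intro i _ _
    rcases i with _ | _ | _ | _ | i
    exacts [ha, hasTrivialBoundary_star p, hasTrivialBoundary_star p, ha,
      hasTrivialBoundary_star p])
  refine ⟨d, hd, h.congr fun i _ ↦ ?_⟩
  rcases i with _ | _ | _ | _ | i <;> rfl

/-- From a filling of the product tuple `(⋆, …, ⋆, a, b, c)` one obtains a filling of a tuple
shifted away from the end by one place, in which `c` and the partner `d` of `a` have changed
sides. -/
theorem IsProduct.filled_shift (hX : SSet.KanComplex X) {a b c d : X _⦋n + 2⦌}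
    (hb : HasTrivialBoundary p b)
    (had : Filled (tuple p d (star p (n + 2)) (star p (n + 2)) a)) (h : IsProduct p c a b) :
    Filled (tuple p (star p (n + 2)) d b c) := by
  rw [isProduct_iff_filled] at h
  let s := star p (n + 2)
  exact Filled.row p hX s d b c s b b s a s 0 (by lia) (absurd rfl)
    (fun _ ↦ filled_degenerate_two hb) (fun _ ↦ had) (fun _ ↦ filled_degenerate_zero hb)
    (fun _ ↦ h)

/-- Apply `IsProduct.filled_shift` to the product `⋆ a = a`: the result says that `⋆ a = d`. -/
theorem homotopic_of_filled_first_last (hX : SSet.KanComplex X) {a d : X _⦋n + 2⦌}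
    (ha : HasTrivialBoundary p a)
    (h : Filled (tuple p d (star p (n + 2)) (star p (n + 2)) a)) : Homotopic a d :=
  (isProduct_star_left ha).homotopic hX (hasTrivialBoundary_star p) ha ha
    (isProduct_iff_filled.2 ((isProduct_star_left ha).filled_shift hX ha h))
    (Homotopic.refl ha)

end

namespace PointedKan

/-! ### The homotopy groups -/

variable (K : PointedKan.{u}) {n : ℕ}

theorem cls_eq {x y : K.space _⦋n⦌} {hx : HasTrivialBoundary K.pt x}
    {hy : HasTrivialBoundary K.pt y} (h : Homotopic x y) : K.cls x hx = K.cls y hy :=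
  Quot.sound h

theorem Pi.ind {C : K.Pi n → Prop} (h : ∀ x hx, C (K.cls x hx)) (a : K.Pi n) : C a :=
  Quot.ind (fun x ↦ h x.1 x.2) a

/-- A chosen product of two representatives. -/
noncomputable def prod (x y : K.Rep (n + 1)) : K.Rep (n + 1) :=
  ⟨(exists_isProduct K.isKan x.2 y.2).choose, (exists_isProduct K.isKan x.2 y.2).choose_spec.1⟩

theorem isProduct_prod (x y : K.Rep (n + 1)) : IsProduct K.pt x.1 y.1 (K.prod x y).1 :=
  (exists_isProduct K.isKan x.2 y.2).choose_spec.2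

/-- The product of homotopy classes. -/
noncomputable abbrev mulPi : Mul (K.Pi (n + 1)) where
  mul := Quot.map₂ K.prod
    (fun x y y' h ↦ (K.isProduct_prod x y).homotopic K.isKan x.2 y.2 y'.2
      (K.isProduct_prod x y') h)
    (fun x x' y h ↦ ((K.isProduct_prod x y).congr_left K.isKan x.2 x'.2 y.2 h).homotopic K.isKan
      x'.2 y.2 y.2 (K.isProduct_prod x' y) (Homotopic.refl y.2))

attribute [local instance] mulPi

theorem cls_mul_cls {x y z : K.space _⦋n + 1⦌} (hx : HasTrivialBoundary K.pt x)
    (hy : HasTrivialBoundary K.pt y) (h : IsProduct K.pt x y z) :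
    K.cls x hx * K.cls y hy = K.cls z (h.hasTrivialBoundary hx hy) :=
  K.cls_eq ((K.isProduct_prod ⟨x, hx⟩ ⟨y, hy⟩).homotopic K.isKan hx hy hy h (Homotopic.refl hy))

/-- The class of the constant simplex. -/
abbrev onePi : One (K.Pi (n + 1)) := ⟨K.cls (star K.pt (n + 1)) (hasTrivialBoundary_star K.pt)⟩

attribute [local instance] onePi

theorem exists_mul_eq_one (a : K.Pi (n + 1)) : ∃ b, b * a = 1 := by
  induction a using Pi.ind with | h y hy
  obtain ⟨x, hx, h⟩ := exists_isProduct_star K.isKan hy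
  exact ⟨K.cls x hx, K.cls_mul_cls hx hy h⟩

/-- A choice of left inverses. -/
noncomputable abbrev invPi : Inv (K.Pi (n + 1)) := ⟨fun a ↦ (K.exists_mul_eq_one a).choose⟩

attribute [local instance] invPi

/-- The group structure on `π_{n+1}`. -/
noncomputable abbrev groupPi : Group (K.Pi (n + 1)) :=
  Group.ofLeftAxioms
    (by
      intro a b c
      induction a using Pi.ind with | h x hx
      induction b using Pi.ind with | h y hy
      induction c using Pi.ind with | h z hz
      obtain ⟨xy, hxy, h₁⟩ := exists_isProduct K.isKan hx hy
      obtain ⟨yz, hyz, h₂⟩ := exists_isProduct K.isKan hy hz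
      obtain ⟨w, hw, h₃⟩ := exists_isProduct K.isKan hx hyz
      rw [K.cls_mul_cls hx hy h₁, K.cls_mul_cls hy hz h₂, K.cls_mul_cls hx hyz h₃,
        K.cls_mul_cls hxy hz (h₁.assoc K.isKan h₂ h₃)])
    (by
      intro a
      induction a using Pi.ind with | h x hx
      exact K.cls_mul_cls _ hx (isProduct_star_left hx))
    (fun a ↦ (K.exists_mul_eq_one a).choose_spec)

attribute [local instance] groupPi

/-- `IsProduct.filled_shift` moves the tuple of `ca = b` away from the end and exchanges the
factors. Replacing all entries by their partners moves it back without an exchange, and does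
not change the classes. -/
theorem mul_comm' (a b : K.Pi (n + 2)) : a * b = b * a := by
  induction a using Pi.ind with | h c hc
  induction b using Pi.ind with | h a ha
  obtain ⟨b, hb, h⟩ := exists_isProduct K.isKan hc ha
  obtain ⟨d, hd, had⟩ := exists_filled_first_last K.isKan ha
  obtain ⟨b', hb', hbb'⟩ := exists_filled_first_last K.isKan hb
  obtain ⟨c', hc', hcc'⟩ := exists_filled_first_last K.isKan hc
  obtain ⟨d', hd', hdd'⟩ := exists_filled_first_last K.isKan hd
  have h' : IsProduct K.pt d' c' b' := by
    rw [isProduct_iff_filled]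
    let s := star K.pt (n + 2)
    exact Filled.row K.pt K.isKan d' b' c' s s s d s b c 0 (by lia) (absurd rfl)
      (fun _ ↦ hdd') (fun _ ↦ hbb') (fun _ ↦ hcc') (fun _ ↦ h.filled_shift K.isKan hb had)
  have e {x y : K.space _⦋n + 2⦌} (hx : HasTrivialBoundary K.pt x)
      (hy : HasTrivialBoundary K.pt y)
      (h : Filled (tuple K.pt y (star K.pt (n + 2)) (star K.pt (n + 2)) x)) :
      K.cls x hx = K.cls y hy := K.cls_eq (homotopic_of_filled_first_last K.isKan hx h)
  rw [K.cls_mul_cls hc ha h, e hb hb' hbb', ← K.cls_mul_cls hd' hc' h', ← e hc hc' hcc',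
    ← e hd hd' hdd', ← e ha hd had]

/-! ### Functoriality -/

theorem Hom.hasTrivialBoundary {K K' : PointedKan.{u}} (f : K ⟶ K') {x : K.space _⦋n⦌}
    (hx : HasTrivialBoundary K.pt x) : HasTrivialBoundary K'.pt (f.map.app (op ⦋n⦌) x) := by
  rw [← f.map_pt]
  exact hx.app f.map

/-- The map induced on homotopy classes. -/
def push (n : ℕ) {K K' : PointedKan.{u}} (f : K ⟶ K') : K.Pi n → K'.Pi n :=
  Quot.map (fun x ↦ ⟨f.map.app (op ⦋n⦌) x.1, Hom.hasTrivialBoundary f x.2⟩) fun x y h ↦ by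
    refine (homotopic_iff_filled (Hom.hasTrivialBoundary f x.2)
      (Hom.hasTrivialBoundary f y.2)).2 ?_
    have := ((homotopic_iff_filled x.2 y.2).1 h).app_tuple f.map
    rwa [f.map_pt, app_star, f.map_pt] at this

theorem push_cls {K K' : PointedKan.{u}} (f : K ⟶ K') {x : K.space _⦋n⦌}
    (hx : HasTrivialBoundary K.pt x) : push n f (K.cls x hx) =
      K'.cls (f.map.app (op ⦋n⦌) x) (Hom.hasTrivialBoundary f hx) := rfl

theorem push_mul {K K' : PointedKan.{u}} (f : K ⟶ K') (a b : K.Pi (n + 1)) :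
    push (n + 1) f (a * b) = push (n + 1) f a * push (n + 1) f b := by
  induction a using Pi.ind with | h x hx
  induction b using Pi.ind with | h y hy
  obtain ⟨z, hz, h⟩ := exists_isProduct K.isKan hx hy
  rw [K.cls_mul_cls hx hy h, push_cls, push_cls, push_cls, K'.cls_mul_cls]
  rw [isProduct_iff_filled] at h ⊢
  have := h.app_tuple f.map
  rwa [f.map_pt, app_star, f.map_pt] at this

theorem push_id {K : PointedKan.{u}} (a : K.Pi n) : push n (𝟙 K) a = a := by
  induction a using Pi.ind
  rfl

theorem push_comp {K K' K'' : PointedKan.{u}} (f : K ⟶ K') (g : K' ⟶ K'') (a : K.Pi n) :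
    push n (f ≫ g) a = push n g (push n f a) := by
  induction a using Pi.ind
  rfl

end PointedKan

/-! ### The path space over a subcomplex -/

/-- The functor that adjoins a new least element to each ordinal. -/
def consFunctor : SimplexCategory ⥤ SimplexCategory where
  obj m := ⦋m.len + 1⦌
  map f := SimplexCategory.Hom.mk
    { toFun := Fin.cases 0 fun i ↦ (f.toOrderHom i).succ
      monotone' := by
        intro i j hij
        induction i using Fin.cases with
        | zero => exact Fin.zero_le _
        | succ i =>
          induction j using Fin.cases with
          | zero => exact absurd hij (by simp)
          | succ j => simpa using f.toOrderHom.monotone (by simpa using hij) }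
  map_id m := by
    ext i : 3
    induction i using Fin.cases <;> rfl
  map_comp f g := by
    ext i : 3
    induction i using Fin.cases <;> rfl

theorem consFunctor_map_δ {n : ℕ} (i : Fin (n + 2)) :
    consFunctor.map (SimplexCategory.δ i) = SimplexCategory.δ i.succ := by
  ext j : 3
  induction j using Fin.cases with
  | zero => exact (Fin.succ_succAbove_zero i).symm
  | succ j => exact (Fin.succ_succAbove_succ i j).symm

/-- The inclusion of an ordinal into the one with a new least element. -/
def consInclusion : 𝟭 SimplexCategory ⟶ consFunctor where
  app m := SimplexCategory.Hom.mk (Fin.succOrderEmb (m.len + 1)).toOrderHom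
  naturality _ _ f := by
    ext j : 3
    rfl

theorem consInclusion_app (n : ℕ) : consInclusion.app ⦋n⦌ = SimplexCategory.δ 0 := by
  ext j : 3
  rfl

theorem const_comp_consFunctor_map {m n : SimplexCategory} (f : m ⟶ n) :
    SimplexCategory.const ⦋0⦌ (consFunctor.obj m) (0 : Fin (m.len + 2)) ≫ consFunctor.map f =
      SimplexCategory.const ⦋0⦌ (consFunctor.obj n) (0 : Fin (n.len + 2)) :=
  SimplexCategory.const_comp _ _ _

section

variable {X : SSet.{u}}

/-- The initial vertex of a simplex of positive dimension. -/
def initialVertex {n : ℕ} (x : X _⦋n + 1⦌) : X _⦋0⦌ :=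
  X.map (SimplexCategory.const ⦋0⦌ ⦋n + 1⦌ 0).op x

theorem initialVertex_δ_succ {n : ℕ} (i : Fin (n + 2)) (x : X _⦋n + 2⦌) :
    initialVertex (X.δ i.succ x) = initialVertex x := by
  simp only [initialVertex, SimplicialObject.δ, ← CategoryTheory.comp_apply, ← Functor.map_comp,
    ← op_comp, SimplexCategory.const_comp]
  congr 4

@[simp]
theorem initialVertex_star (p : X _⦋0⦌) (n : ℕ) : initialVertex (star p (n + 1)) = p := by
  rw [initialVertex, map_star, star_zero]

theorem δ_one_eq_initialVertex (x : X _⦋1⦌) : X.δ 1 x = initialVertex x := by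
  rw [SimplicialObject.δ, SimplexCategory.δ_one_eq_const]
  rfl

/-- The path space of paths that start at `p` and end in `A`: its `n`-simplices are the
`(n + 1)`-simplices of `X` whose initial vertex is `p` and whose face opposite to it lies in `A`.
The faces of such a simplex are its remaining faces in `X`. -/
def pathSpace (A : X.Subcomplex) (p : X _⦋0⦌) : SSet.Subcomplex (consFunctor.op ⋙ X) where
  obj m := {x | X.map (consInclusion.app m.unop).op x ∈ A.obj m ∧
    X.map (SimplexCategory.const ⦋0⦌ (consFunctor.obj m.unop) (0 : Fin (m.unop.len + 2))).op x = p}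
  map {m m'} f x := by
    rintro ⟨h₁, h₂⟩
    refine ⟨?_, ?_⟩
    · have e : X.map (consInclusion.app m'.unop).op (X.map (consFunctor.map f.unop).op x) =
          X.map f (X.map (consInclusion.app m.unop).op x) := by
        simp only [← CategoryTheory.comp_apply, ← Functor.map_comp, ← op_comp]
        rw [← consInclusion.naturality f.unop]
        simp
      exact e ▸ A.map f h₁
    · rw [← h₂]
      simp only [Functor.comp_map, Functor.op_map, ← CategoryTheory.comp_apply,
        ← Functor.map_comp, ← op_comp]
      rw [const_comp_consFunctor_map]

variable {A : X.Subcomplex} {p : X _⦋0⦌} {n : ℕ}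

theorem mem_pathSpace_iff {x : X _⦋n + 1⦌} : x ∈ (pathSpace A p).obj (op ⦋n⦌) ↔
    X.δ 0 x ∈ A.obj (op ⦋n⦌) ∧ initialVertex x = p := by
  rw [SimplicialObject.δ, ← consInclusion_app]
  rfl

theorem mem_pathSpace_of_δ {w : X _⦋n + 2⦌} (h : X.δ 0 w ∈ A.obj (op ⦋n + 1⦌)) (i : Fin (n + 2))
    (hi : initialVertex (X.δ i.succ w) = p) : w ∈ (pathSpace A p).obj (op ⦋n + 1⦌) :=
  mem_pathSpace_iff.2 ⟨h, by rwa [initialVertex_δ_succ] at hi⟩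

namespace pathSpace

/-- The simplex of `X` underlying a simplex of the path space. -/
def val (x : (pathSpace A p : SSet.{u}) _⦋n⦌) : X _⦋n + 1⦌ := x.1

/-- The simplex of the path space given by a simplex of `X`. -/
def mk (x : X _⦋n + 1⦌) (hx : x ∈ (pathSpace A p).obj (op ⦋n⦌)) :
    (pathSpace A p : SSet.{u}) _⦋n⦌ := ⟨x, hx⟩

@[simp]
theorem val_mk (x : X _⦋n + 1⦌) (hx : x ∈ (pathSpace A p).obj (op ⦋n⦌)) : val (mk x hx) = x := rfl

theorem ext_val {x y : (pathSpace A p : SSet.{u}) _⦋n⦌} (h : val x = val y) : x = y :=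
  Subtype.ext h

theorem val_mem (x : (pathSpace A p : SSet.{u}) _⦋n⦌) :
    val x ∈ (pathSpace A p).obj (op ⦋n⦌) := x.2

theorem δ_zero_val_mem (x : (pathSpace A p : SSet.{u}) _⦋n⦌) :
    X.δ 0 (val x) ∈ A.obj (op ⦋n⦌) := (mem_pathSpace_iff.1 (val_mem x)).1

@[simp]
theorem initialVertex_val (x : (pathSpace A p : SSet.{u}) _⦋n⦌) : initialVertex (val x) = p :=
  (mem_pathSpace_iff.1 (val_mem x)).2

theorem val_δ (i : Fin (n + 2)) (x : (pathSpace A p : SSet.{u}) _⦋n + 1⦌) :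
    val ((pathSpace A p : SSet.{u}).δ i x) = X.δ i.succ (val x) := by
  rw [SimplicialObject.δ, SimplicialObject.δ, ← consFunctor_map_δ]
  rfl

/-- To fill a horn of the path space, fill first the horn in `A` formed by the end points, and
then the horn in `X` formed by that filling and the given faces. -/
theorem kanComplex (hX : SSet.KanComplex X) (hA : SSet.KanComplex (A : SSet.{u})) :
    SSet.KanComplex (pathSpace A p : SSet.{u}) := by
  refine kanComplex_of_exists_simplex fun n k y hy ↦ ?_
  have hxy (i j : Fin (n + 2)) (hij : i ≤ j) (hi : i.castSucc ≠ k) (hj : j.succ ≠ k) :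
      X.δ i.succ (val (y j.succ)) = X.δ j.succ (val (y i.castSucc)) := by
    rw [← val_δ, ← val_δ, hy i j hij hi hj]
  obtain ⟨a, ha⟩ := exists_simplex_of_horn hA k (fun j ↦ ⟨X.δ 0 (val (y j)), δ_zero_val_mem _⟩) (by
    intro i j hij hi hj
    refine Subtype.ext ?_
    change X.δ i (X.δ 0 (val (y j.succ))) = X.δ j (X.δ 0 (val (y i.castSucc)))
    have h (l : Fin (n + 2)) (z : X _⦋n + 2⦌) : X.δ l (X.δ 0 z) = X.δ 0 (X.δ l.succ z) :=
      (X.δ_comp_δ_apply (Fin.zero_le l) z).symm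
    rw [h, h, hxy i j hij hi hj])
  obtain ⟨a, haA⟩ := a
  replace ha (j : Fin (n + 3)) (hj : j ≠ k) : X.δ j a = X.δ 0 (val (y j)) :=
    congrArg Subtype.val (ha j hj)
  -- The horn in `X` is missing the face `k + 1`, and its face `0` is `a`.
  obtain ⟨v, hv⟩ := exists_simplex_of_horn hX k.succ
    (Fin.cases (motive := fun _ ↦ X _⦋n + 2⦌) a fun j ↦ val (y j)) (by
      intro i j hij hi hj
      rw [Ne, Fin.succ_inj] at hj
      induction i using Fin.cases with
      | zero => exact (ha j hj).symm
      | succ i =>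
        obtain ⟨j, rfl⟩ := j.eq_succ_of_ne_zero (by rintro rfl; simp at hij)
        rw [← Fin.succ_castSucc, Ne, Fin.succ_inj] at hi
        exact hxy i j (Fin.succ_le_succ_iff.1 hij) hi hj)
  have hv' (j : Fin (n + 3)) (hj : j ≠ k) : X.δ j.succ v = val (y j) :=
    hv j.succ (by rwa [Ne, Fin.succ_inj])
  refine ⟨mk v (mem_pathSpace_of_δ ?_ (k.succAbove 0) ?_), fun j hj ↦ ext_val ?_⟩
  · rw [hv 0 (Fin.succ_ne_zero k).symm]
    exact haA
  · rw [hv' _ (Fin.succAbove_ne k 0), initialVertex_val]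
  · rw [val_δ, val_mk, hv' j hj]

/-- The constant path. -/
def base (hp : p ∈ A.obj (op ⦋0⦌)) : (pathSpace A p : SSet.{u}) _⦋0⦌ :=
  mk (star p 1) (mem_pathSpace_iff.2 ⟨by rwa [δ_star, star_zero], initialVertex_star _ _⟩)

variable (hp : p ∈ A.obj (op ⦋0⦌))

@[simp]
theorem val_star_base : val (star (base hp) n) = star p (n + 1) :=
  map_star p _

theorem hasTrivialBoundary_iff {x : (pathSpace A p : SSet.{u}) _⦋n⦌} :
    HasTrivialBoundary (base hp) x ↔ HasRelTrivialBoundary A p (val x) := by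
  refine Iff.trans ?_ (and_iff_right (δ_zero_val_mem x)).symm
  obtain _ | n := n
  -- A vertex of the path space satisfies the relative condition because of its initial vertex.
  · refine iff_of_true trivial fun i ↦ ?_
    obtain rfl := Fin.fin_one_eq_zero i
    rw [star_zero]
    exact (δ_one_eq_initialVertex _).trans (initialVertex_val x)
  · refine forall_congr' fun i ↦ ?_
    rw [← val_star_base hp, ← val_δ]
    exact ⟨congrArg val, ext_val⟩

theorem _root_.KanHomotopy.HasRelTrivialBoundary.mem_pathSpace {x : X _⦋n + 1⦌}
    (hx : HasRelTrivialBoundary A p x) : x ∈ (pathSpace A p).obj (op ⦋n⦌) := by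
  obtain _ | n := n
  · refine mem_pathSpace_iff.2 ⟨hx.1, ?_⟩
    rw [← δ_one_eq_initialVertex]
    exact (hx.2 0).trans (star_zero _)
  · exact mem_pathSpace_of_δ hx.1 0 (by rw [hx.2 0, initialVertex_star])

theorem relHomotopic_iff {x y : (pathSpace A p : SSet.{u}) _⦋n⦌}
    (hx : HasTrivialBoundary (base hp) x) (hy : HasTrivialBoundary (base hp) y) :
    RelHomotopic A (val x) (val y) ↔ Homotopic x y := by
  have hx' := (hasTrivialBoundary_iff hp).1 hx
  have hy' := (hasTrivialBoundary_iff hp).1 hy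
  refine (and_iff_right fun i ↦ (hx'.2 i).trans (hy'.2 i).symm).trans
    ((and_iff_right hx'.1).trans ((and_iff_right hy'.1).trans ?_))
  obtain _ | n := n
  · constructor
    · rintro ⟨w, h₀, -, h₁, h₂⟩
      refine ⟨mk w (mem_pathSpace_of_δ h₀ 0 ?_), ext_val ?_, ext_val ?_⟩
      · exact (congrArg initialVertex h₁).trans (initialVertex_val x)
      · exact (val_δ _ _).trans h₁
      · exact (val_δ _ _).trans h₂
    · rintro ⟨w, rfl, rfl⟩
      exact ⟨val w, δ_zero_val_mem w, fun i ↦ i.elim0, (val_δ 0 w).symm, (val_δ 1 w).symm⟩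
  · refine Iff.trans ?_ (and_iff_right fun i ↦ (hx i).trans (hy i).symm).symm
    -- On representatives the degenerate faces in both definitions of homotopy are constant.
    have hσ (i : Fin (n + 1)) :
        X.σ (Fin.last (n + 1)) (X.δ i.succ.castSucc (val x)) = star p (n + 2) := by
      rw [← σ_star p (Fin.last (n + 1)), ← hx'.2 i.castSucc]
      rfl
    have hσ' (i : Fin (n + 1)) : (pathSpace A p : SSet.{u}).σ (Fin.last n)
        ((pathSpace A p : SSet.{u}).δ i.castSucc x) = star (base hp) (n + 1) := by
      rw [← σ_star _ (Fin.last n), ← hx i.castSucc]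
    constructor
    · rintro ⟨w, h₀, h, h₁, h₂⟩
      refine ⟨mk w (mem_pathSpace_of_δ h₀ (Fin.last _) ?_), fun i ↦ ext_val ?_, ext_val ?_,
        ext_val ?_⟩
      · exact (congrArg initialVertex h₂).trans (initialVertex_val y)
      · rw [hσ', val_star_base, val_δ, val_mk, ← hσ i]
        exact h i
      · exact (val_δ _ _).trans h₁
      · exact (val_δ _ _).trans h₂
    · rintro ⟨w, h, h₁, h₂⟩
      refine ⟨val w, δ_zero_val_mem w, fun i ↦ ?_, ?_, ?_⟩
      · rw [hσ, ← val_star_base hp, ← hσ' i, ← h i, val_δ]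
        rfl
      · rw [← h₁, val_δ]
        rfl
      · rw [← h₂, val_δ]
        rfl

theorem isRelProduct_iff {x y : (pathSpace A p : SSet.{u}) _⦋n + 1⦌} {z : X _⦋n + 2⦌} :
    IsRelProduct A p (val x) (val y) z ↔
      ∃ hz : z ∈ (pathSpace A p).obj (op ⦋n + 1⦌), IsProduct (base hp) x y (mk z hz) := by
  constructor
  · rintro ⟨w, h₀, h, h₁, h₂, h₃⟩
    have hw : w ∈ (pathSpace A p).obj (op ⦋n + 2⦌) := mem_pathSpace_of_δ h₀ (Fin.last _)
      ((congrArg initialVertex h₃).trans (initialVertex_val x))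
    have hz : val ((pathSpace A p : SSet.{u}).δ (Fin.last (n + 1)).castSucc (mk w hw)) = z :=
      (val_δ _ _).trans h₂
    refine ⟨hz ▸ val_mem _, mk w hw, fun i ↦ ext_val ?_, ext_val ?_, ext_val hz, ext_val ?_⟩
    · rw [val_star_base]
      exact (val_δ _ _).trans (h i)
    · exact (val_δ _ _).trans h₁
    · exact (val_δ _ _).trans h₃
  · rintro ⟨hz, w, h, h₁, h₂, h₃⟩
    refine ⟨val w, δ_zero_val_mem w, fun i ↦ ?_, ?_, ?_, ?_⟩
    · rw [← val_star_base hp, ← h i, val_δ]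
      rfl
    · rw [← h₁, val_δ]
      rfl
    · rw [← val_mk z hz, ← h₂, val_δ]
      rfl
    · rw [← h₃, val_δ]
      rfl

end pathSpace

end

namespace PointedKanPair

/-! ### Relative homotopy classes -/

/-- The path space of a pointed Kan pair, based at the constant path. -/
def path (K : PointedKanPair.{u}) : PointedKan.{u} where
  space := pathSpace K.sub K.pt
  isKan := pathSpace.kanComplex K.isKan K.isKan_sub
  pt := pathSpace.base K.pt_mem

variable {K : PointedKanPair.{u}} {n : ℕ}

variable (K n) in
/-- The representatives of relative classes are the representatives in the path space. -/
def repEquiv : K.RepSucc n ≃ K.path.Rep n where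
  toFun x := ⟨pathSpace.mk x.1 x.2.mem_pathSpace,
    (pathSpace.hasTrivialBoundary_iff K.pt_mem).2 x.2⟩
  invFun x := ⟨pathSpace.val x.1, (pathSpace.hasTrivialBoundary_iff K.pt_mem).1 x.2⟩
  left_inv _ := rfl
  right_inv _ := rfl

theorem relSucc_iff (x y : K.RepSucc n) :
    K.RelSucc n x y ↔ K.path.Rel n (K.repEquiv n x) (K.repEquiv n y) :=
  pathSpace.relHomotopic_iff K.pt_mem (K.repEquiv n x).2 (K.repEquiv n y).2

theorem relSucc_equivalence (K : PointedKanPair.{u}) (n : ℕ) : Equivalence (K.RelSucc n) := by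
  have e : K.RelSucc n = fun x y ↦ K.path.Rel n (K.repEquiv n x) (K.repEquiv n y) := by
    funext x y
    exact propext (relSucc_iff x y)
  rw [e]
  exact (K.path.rel_equivalence n).comap (K.repEquiv n)

variable (K n) in
/-- The relative homotopy classes are the homotopy classes of the path space, one dimension
lower. -/
def piEquiv : K.PiSucc n ≃ K.path.Pi n := Quot.congr (K.repEquiv n) relSucc_iff

attribute [local instance] PointedKan.groupPi

variable (K n) in
/-- The group structure on `π_{n+2}` of a pair. -/
noncomputable abbrev groupPiSucc : Group (K.PiSucc (n + 1)) :=
  (K.piEquiv (n + 1)).group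

attribute [local instance] groupPiSucc

theorem piEquiv_mul (a b : K.PiSucc (n + 1)) :
    K.piEquiv (n + 1) (a * b) = K.piEquiv (n + 1) a * K.piEquiv (n + 1) b :=
  (K.piEquiv (n + 1)).apply_symm_apply _

theorem mul_comm' (a b : K.PiSucc (n + 2)) : a * b = b * a :=
  (K.piEquiv (n + 2)).injective (by rw [piEquiv_mul, piEquiv_mul, PointedKan.mul_comm'])

theorem exists_isRelProduct {x y : K.space _⦋n + 2⦌} (hx : HasRelTrivialBoundary K.sub K.pt x)
    (hy : HasRelTrivialBoundary K.sub K.pt y) : ∃ z, IsRelProduct K.sub K.pt x y z := by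
  obtain ⟨z, -, h⟩ := exists_isProduct K.path.isKan (K.repEquiv _ ⟨x, hx⟩).2
    (K.repEquiv _ ⟨y, hy⟩).2
  exact ⟨pathSpace.val z, (pathSpace.isRelProduct_iff K.pt_mem).2 ⟨pathSpace.val_mem z, h⟩⟩

theorem cls_mul_cls {x y z : K.space _⦋n + 2⦌} (hx : HasRelTrivialBoundary K.sub K.pt x)
    (hy : HasRelTrivialBoundary K.sub K.pt y) (h : IsRelProduct K.sub K.pt x y z) :
    ∃ hz : HasRelTrivialBoundary K.sub K.pt z, K.cls x hx * K.cls y hy = K.cls z hz := by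
  have hx' := (K.repEquiv _ ⟨x, hx⟩).2
  have hy' := (K.repEquiv _ ⟨y, hy⟩).2
  obtain ⟨hz, h⟩ := (pathSpace.isRelProduct_iff K.pt_mem
    (x := pathSpace.mk x hx.mem_pathSpace) (y := pathSpace.mk y hy.mem_pathSpace)).1 h
  refine ⟨(pathSpace.hasTrivialBoundary_iff K.pt_mem).1 (h.hasTrivialBoundary hx' hy'),
    (K.piEquiv _).injective ?_⟩
  exact (piEquiv_mul _ _).trans (K.path.cls_mul_cls hx' hy' h)

/-- The map of path spaces induced by a map of pairs. -/
def pathMap {K K' : PointedKanPair.{u}} (f : K ⟶ K') : K.path ⟶ K'.path where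
  map := SSet.Subcomplex.lift (B := pathSpace K'.sub K'.pt)
    ((pathSpace K.sub K.pt).ι ≫ Functor.whiskerLeft consFunctor.op f.map) (by
      rintro ⟨⟨n⟩⟩ _ ⟨x, rfl⟩
      refine mem_pathSpace_iff.2 ⟨?_, ?_⟩
      · change K'.space.δ 0 (f.map.app (op ⦋n + 1⦌) (pathSpace.val x)) ∈ _
        rw [← SSet.δ_naturality_apply]
        exact f.map_sub n _ (pathSpace.δ_zero_val_mem x)
      · refine (NatTrans.naturality_apply f.map _ _).symm.trans ?_
        exact (congrArg _ (pathSpace.initialVertex_val x)).trans f.map_pt)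
  map_pt := pathSpace.ext_val ((app_star K.pt f.map 1).trans (by rw [f.map_pt]; rfl))

theorem hasRelTrivialBoundary_app {K K' : PointedKanPair.{u}} (f : K ⟶ K') {x : K.space _⦋n + 1⦌}
    (hx : HasRelTrivialBoundary K.sub K.pt x) :
    HasRelTrivialBoundary K'.sub K'.pt (f.map.app (op ⦋n + 1⦌) x) :=
  (pathSpace.hasTrivialBoundary_iff K'.pt_mem).1
    (PointedKan.Hom.hasTrivialBoundary (pathMap f) (K.repEquiv _ ⟨x, hx⟩).2)

/-- The map induced on relative homotopy classes. -/
def push (n : ℕ) {K K' : PointedKanPair.{u}} (f : K ⟶ K') (a : K.PiSucc n) : K'.PiSucc n :=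
  (K'.piEquiv n).symm (PointedKan.push n (pathMap f) (K.piEquiv n a))

theorem push_cls {K K' : PointedKanPair.{u}} (f : K ⟶ K') {x : K.space _⦋n + 1⦌}
    (hx : HasRelTrivialBoundary K.sub K.pt x) :
    push n f (K.cls x hx) = K'.cls (f.map.app (op ⦋n + 1⦌) x) (hasRelTrivialBoundary_app f hx) :=
  rfl

theorem push_mul {K K' : PointedKanPair.{u}} (f : K ⟶ K') (a b : K.PiSucc (n + 1)) :
    push (n + 1) f (a * b) = push (n + 1) f a * push (n + 1) f b :=
  (K'.piEquiv (n + 1)).injective (by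
    simp only [push, piEquiv_mul, PointedKan.push_mul, Equiv.apply_symm_apply])

theorem push_id {K : PointedKanPair.{u}} (a : K.PiSucc n) : push n (𝟙 K) a = a := by
  induction a using Quot.ind
  rfl

theorem push_comp {K K' K'' : PointedKanPair.{u}} (f : K ⟶ K') (g : K' ⟶ K'')
    (a : K.PiSucc n) : push n (f ≫ g) a = push n g (push n f a) := by
  induction a using Quot.ind
  rfl

end PointedKanPair

end KanHomotopy

open KanHomotopy in
theorem mainTheorem1 :
    -- absolute case: `π_n` for `n ≥ 0`, product on `π_{n+1}`, commutativity on `π_{n+2}`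
    ((∀ (K : PointedKan.{u}) (n : ℕ), Equivalence (K.Rel n)) ∧
      ∃ (grp : ∀ (K : PointedKan.{u}) (n : ℕ), Group (K.Pi (n + 1)))
        (push : ∀ (n : ℕ) {K K' : PointedKan.{u}}, (K ⟶ K') → K.Pi n → K'.Pi n),
        (∀ (K : PointedKan.{u}) (n : ℕ) (x y : K.space _⦋n + 1⦌)
            (hx : HasTrivialBoundary K.pt x) (hy : HasTrivialBoundary K.pt y),
          (∃ z, IsProduct K.pt x y z) ∧
          ∀ z, IsProduct K.pt x y z →
            ∃ hz : HasTrivialBoundary K.pt z, K.cls x hx * K.cls y hy = K.cls z hz) ∧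
        (∀ (K : PointedKan.{u}) (n : ℕ) (a b : K.Pi (n + 2)), a * b = b * a) ∧
        (∀ (n : ℕ) (K K' : PointedKan.{u}) (f : K ⟶ K') (x : K.space _⦋n⦌)
            (hx : HasTrivialBoundary K.pt x),
          ∃ hfx : HasTrivialBoundary K'.pt (f.map.app (op ⦋n⦌) x),
            push n f (K.cls x hx) = K'.cls (f.map.app (op ⦋n⦌) x) hfx) ∧
        (∀ (n : ℕ) (K : PointedKan.{u}) (a : K.Pi n), push n (𝟙 K) a = a) ∧
        (∀ (n : ℕ) (K K' K'' : PointedKan.{u}) (f : K ⟶ K') (g : K' ⟶ K'') (a : K.Pi n),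
          push n (f ≫ g) a = push n g (push n f a)) ∧
        (∀ (n : ℕ) (K K' : PointedKan.{u}) (f : K ⟶ K') (a b : K.Pi (n + 1)),
          push (n + 1) f (a * b) = push (n + 1) f a * push (n + 1) f b)) ∧
    -- relative case: `PiSucc n` is `π_{n+1}`, product on `π_{n+2}`, commutativity on `π_{n+3}`
    ((∀ (K : PointedKanPair.{u}) (n : ℕ), Equivalence (K.RelSucc n)) ∧
      ∃ (grp : ∀ (K : PointedKanPair.{u}) (n : ℕ), Group (K.PiSucc (n + 1)))
        (push : ∀ (n : ℕ) {K K' : PointedKanPair.{u}}, (K ⟶ K') → K.PiSucc n → K'.PiSucc n),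
        (∀ (K : PointedKanPair.{u}) (n : ℕ) (x y : K.space _⦋n + 2⦌)
            (hx : HasRelTrivialBoundary K.sub K.pt x) (hy : HasRelTrivialBoundary K.sub K.pt y),
          (∃ z, IsRelProduct K.sub K.pt x y z) ∧
          ∀ z, IsRelProduct K.sub K.pt x y z →
            ∃ hz : HasRelTrivialBoundary K.sub K.pt z, K.cls x hx * K.cls y hy = K.cls z hz) ∧
        (∀ (K : PointedKanPair.{u}) (n : ℕ) (a b : K.PiSucc (n + 2)), a * b = b * a) ∧
        (∀ (n : ℕ) (K K' : PointedKanPair.{u}) (f : K ⟶ K') (x : K.space _⦋n + 1⦌)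
            (hx : HasRelTrivialBoundary K.sub K.pt x),
          ∃ hfx : HasRelTrivialBoundary K'.sub K'.pt (f.map.app (op ⦋n + 1⦌) x),
            push n f (K.cls x hx) = K'.cls (f.map.app (op ⦋n + 1⦌) x) hfx) ∧
        (∀ (n : ℕ) (K : PointedKanPair.{u}) (a : K.PiSucc n), push n (𝟙 K) a = a) ∧
        (∀ (n : ℕ) (K K' K'' : PointedKanPair.{u}) (f : K ⟶ K') (g : K' ⟶ K'')
            (a : K.PiSucc n), push n (f ≫ g) a = push n g (push n f a)) ∧
        (∀ (n : ℕ) (K K' : PointedKanPair.{u}) (f : K ⟶ K') (a b : K.PiSucc (n + 1)),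
          push (n + 1) f (a * b) = push (n + 1) f a * push (n + 1) f b)) := by
  refine ⟨⟨PointedKan.rel_equivalence, fun K n ↦ K.groupPi, fun n _ _ f ↦ PointedKan.push n f,
      ?_, fun K _ ↦ K.mul_comm', ?_, fun _ _ ↦ PointedKan.push_id,
      fun _ _ _ _ ↦ PointedKan.push_comp, fun _ _ _ ↦ PointedKan.push_mul⟩,
    PointedKanPair.relSucc_equivalence, fun K n ↦ K.groupPiSucc n,
      fun n _ _ f ↦ PointedKanPair.push n f,
      ?_, fun _ _ ↦ PointedKanPair.mul_comm', ?_, fun _ _ ↦ PointedKanPair.push_id,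
      fun _ _ _ _ ↦ PointedKanPair.push_comp, fun _ _ _ ↦ PointedKanPair.push_mul⟩
  · intro K n x y hx hy
    obtain ⟨z, -, hz⟩ := exists_isProduct K.isKan hx hy
    exact ⟨⟨z, hz⟩, fun w hw ↦ ⟨hw.hasTrivialBoundary hx hy, K.cls_mul_cls hx hy hw⟩⟩
  · exact fun n K K' f x hx ↦ ⟨PointedKan.Hom.hasTrivialBoundary f hx, PointedKan.push_cls f hx⟩
  · exact fun K n x y hx hy ↦ ⟨PointedKanPair.exists_isRelProduct hx hy,
      fun z hz ↦ PointedKanPair.cls_mul_cls hx hy hz⟩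
  · exact fun n K K' f x hx ↦
      ⟨PointedKanPair.hasRelTrivialBoundary_app f hx, PointedKanPair.push_cls f hx⟩
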